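/- For a group $G$ and an endomorphism $\varphi\in\operatorname{End}(G)$, call $x,y\in G$ \emph{$\varphi$-conjugate} if $x=zy\varphi(z)^{-1}$ for some $z\in G$; this is an equivalence relation, and the \emph{Reidemeister number} $R(\varphi)\in\{1,2,3,\dots\}\cup\{\infty\}$ is the number of its equivalence classes. The group $G$ has the \emph{$R_\infty$-property} if $\{R(\psi)\mid\psi\in\operatorname{Aut}(G)\}=\{\infty\}$, i.e. $R(\psi)=\infty$ for every automorphism $\psi$ of $G$. \textbf{Proposition.} Let $N$ be a finitely generated torsion-free nilpotent group and let $H$ be a normal subgroup of $N$ such that $N/H$ is torsion-free. Let $\varphi\in\operatorname{End}(N)$ be an endomorphism with $\varphi(H)\le H$, and let $\varphi|_H\in\operatorname{End}(H)$ and $\bar\varphi\in\operatorname{End}(N/H)$ denote its restriction to $H$ and the endomorphism $gH\mapsto\varphi(g)H$ it induces on $N/H$, respectively. Then \[ R(\varphi)=R(\varphi|_H)\,R(\bar\varphi), \] where the product equals $\infty$ if one of the factors is $\infty$. In particular, if $H$ is characteristic in $N$ (and $N/H$ is torsion-free, as above) and $H$ has the $R_\infty$-property, then $N$ has the $R_\infty$-property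 as well. -/

import Mathlib

namespace TwistedConj

universe u

/-- `G` is torsion-free: the only element of finite order is the identity. (On non-abelian groups
this is a priori weaker than `IsMulTorsionFree`, which asks for uniqueness of roots.) -/
def TorsionFree (G : Type u) [Group G] : Prop :=
  ∀ g : G, IsOfFinOrder g → g = 1

/-- The relation of `φ`-conjugacy: `x = z y φ(z)⁻¹` for some `z`. -/
def reidemeisterSetoid {G : Type u} [Group G] (φ : G →* G) : Setoid G where
  r x y := ∃ z : G, x = z * y * (φ z)⁻¹
  iseqv :=
    { refl := fun x => ⟨1, by simp⟩
      symm := by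
        rintro x y ⟨z, rfl⟩
        exact ⟨z⁻¹, by simp [mul_assoc]⟩
      trans := by
        rintro x y w ⟨z, rfl⟩ ⟨t, rfl⟩
        exact ⟨z * t, by simp [mul_assoc]⟩ }

/-- The Reidemeister number `R(φ)`: the number of `φ`-conjugacy classes, in `ℕ ∪ {∞}`. -/
noncomputable def reidemeisterNumber {G : Type u} [Group G] (φ : G →* G) : ℕ∞ :=
  ENat.card (Quotient (reidemeisterSetoid φ))

/-- The Reidemeister spectrum: the set of Reidemeister numbers of automorphisms of `G`. -/
def reidemeisterSpectrum (G : Type u) [Group G] : Set ℕ∞ :=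
  Set.range fun ψ : MulAut G => reidemeisterNumber ψ.toMonoidHom

/-- The `R_∞`-property: the Reidemeister spectrum is `{∞}`. -/
def HasRInfinity (G : Type u) [Group G] : Prop :=
  reidemeisterSpectrum G = {⊤}

/-- The restriction of `φ` to a subgroup `H` with `φ(H) ≤ H`, as an endomorphism of `H`. -/
def restrictEnd {G : Type u} [Group G] (φ : G →* G) (H : Subgroup G) (h : H.map φ ≤ H) :
    H →* H :=
  (φ.comp H.subtype).codRestrict H fun x => h (Subgroup.mem_map_of_mem φ x.2)

/-- The endomorphism `gH ↦ φ(g)H` of `G ⧸ H` induced by `φ`, for `H` normal with `φ(H) ≤ H`. -/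
def quotientEnd {G : Type u} [Group G] (φ : G →* G) (H : Subgroup G) [H.Normal]
    (h : H.map φ ≤ H) : G ⧸ H →* G ⧸ H :=
  QuotientGroup.map H H φ (Subgroup.map_le_iff_le_comap.mp h)

end TwistedConj

/-! Suppose first that `H` is central. If `R(φ̄) = ∞`, both sides are infinite. Otherwise every
inner twist of `φ̄` also has finite Reidemeister number, hence no nontrivial fixed point, and the
classes of `φ` are then parametrized without repetition by pairs of classes of `φ|_H` and `φ̄`
(`reidemeisterNumber_eq_mul_of_central`). That finite `R` forces trivial fixed points is a
Fitting-type argument for abelian groups, extended along central steps.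

In general, induct on `n` with `H ≤ Z_n(N)`. Let `H'` be the isolator of `[H, N]` in `H`. Then `H' ≤
Z_{n-1}(N)`, `N/H'` is torsion-free and `H/H'` is central in it. Induction for `H' ≤ N` and `H' ≤
H`, with the central case for `H/H' ≤ N/H'`, gives the formula. -/

namespace TwistedConj

open scoped commutatorElement

/-! ### Ascending chain condition in finitely generated nilpotent groups -/

section AscendingChain

variable {G Q : Type*} [Group G] [Group Q]

theorem wellFoundedGT_subgroup_of_injective [WellFoundedGT (Subgroup Q)] (f : G →* Q)
    (hf : Function.Injective f) : WellFoundedGT (Subgroup G) :=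
  StrictMono.wellFoundedGT (f := Subgroup.map f)
    ((Subgroup.gc_map_comap f).monotone_l.strictMono_of_injective (Subgroup.map_injective hf))

theorem wellFoundedGT_subgroup_of_surjective [WellFoundedGT (Subgroup G)] (f : G →* Q)
    (hf : Function.Surjective f) : WellFoundedGT (Subgroup Q) :=
  StrictMono.wellFoundedGT (f := Subgroup.comap f)
    ((Subgroup.gc_map_comap f).monotone_u.strictMono_of_injective (Subgroup.comap_injective hf))

theorem wellFoundedGT_subgroup_of_ker (f : G →* Q) [WellFoundedGT (Subgroup Q)]
    [WellFoundedGT (Subgroup f.ker)] : WellFoundedGT (Subgroup G) := by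
  refine StrictMono.wellFoundedGT (β := Subgroup f.ker × Subgroup Q)
    (f := fun P => (P.subgroupOf f.ker, P.map f)) fun P R hPR => ?_
  refine lt_of_le_of_ne ⟨Subgroup.comap_mono hPR.le, Subgroup.map_mono hPR.le⟩ fun h => ?_
  obtain ⟨h₁, h₂⟩ := Prod.mk.inj h
  refine hPR.not_ge fun x hx => ?_
  obtain ⟨y, hy, hxy⟩ : f x ∈ P.map f := h₂ ▸ Subgroup.mem_map_of_mem f hx
  have hk : y⁻¹ * x ∈ f.ker := by simp [MonoidHom.mem_ker, hxy]
  have : (⟨y⁻¹ * x, hk⟩ : f.ker) ∈ P.subgroupOf f.ker := by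
    rw [h₁]
    exact R.mul_mem (R.inv_mem (hPR.le hy)) hx
  simpa using P.mul_mem hy (Subgroup.mem_subgroupOf.mp this)

theorem wellFoundedGT_subgroup_of_commGroup_fg (A : Type*) [CommGroup A] [Group.FG A] :
    WellFoundedGT (Subgroup A) := by
  have : Module.Finite ℤ (Additive A) := Module.Finite.iff_addGroup_fg.mpr inferInstance
  have : WellFoundedGT (Submodule ℤ (Additive A)) := inferInstance
  exact StrictMono.wellFoundedGT
    (Subgroup.toAddSubgroup.trans (AddSubgroup.toIntSubmodule (M := Additive A))).strictMono

/-- Modulo `γ (n + 2)`, commutators of generators of `γ n` modulo `γ (n + 1)` with generators of `G`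
already generate `γ (n + 1)`: modulo the subgroup `M` below, all of `γ n` becomes central. -/
theorem exists_finite_le_closure_sup_lowerCentralSeries [Group.FG G] (n : ℕ) :
    ∃ S : Set G, S.Finite ∧ S ⊆ (⊤ : Subgroup G).lowerCentralSeries n ∧
      (⊤ : Subgroup G).lowerCentralSeries n ≤
        Subgroup.closure S ⊔ (⊤ : Subgroup G).lowerCentralSeries (n + 1) := by
  obtain ⟨T, hT, hTfin⟩ := Group.fg_iff.mp ‹Group.FG G›
  induction n with
  | zero => exact ⟨T, hTfin, fun _ _ => Subgroup.mem_top _, by simp [hT]⟩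
  | succ n ih =>
    obtain ⟨S, hSfin, hS, hle⟩ := ih
    set γ := (⊤ : Subgroup G).lowerCentralSeries with hγ
    have hcomm (k : ℕ) {x : G} (hx : x ∈ γ k) (y : G) : ⁅x, y⁆ ∈ γ (k + 1) := by
      rw [hγ, Subgroup.lowerCentralSeries_succ]
      exact Subgroup.commutator_mem_commutator hx (Subgroup.mem_top y)
    set S' : Set G := Set.image2 (fun s t => ⁅s, t⁆) S T
    have hS'sub : S' ⊆ γ (n + 1) := by
      rintro _ ⟨s, hs, t, -, rfl⟩
      exact hcomm n (hS hs) t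
    refine ⟨S', hSfin.image2 _ hTfin, hS'sub, ?_⟩
    set M := Subgroup.closure S' ⊔ γ (n + 2)
    have hMle : M ≤ γ (n + 1) :=
      sup_le ((Subgroup.closure_le _).mpr hS'sub) (Subgroup.lowerCentralSeries_antitone _ (by omega))
    have hMn : M.Normal := ⟨fun x hx g => by
      have h : ⁅x, g⁆ ∈ M := (le_sup_right : _ ≤ M) (hcomm (n + 1) (hMle hx) g)
      have : g * x * g⁻¹ = ⁅x, g⁆⁻¹ * x := by group
      rw [this]
      exact M.mul_mem (M.inv_mem h) hx⟩
    have hcen {x : G} (h : ∀ y, ⁅x, y⁆ ∈ M) : x ∈ (Subgroup.center (G ⧸ M)).comap (QuotientGroup.mk' M) := by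
      rw [Subgroup.mem_comap, Subgroup.mem_center_iff]
      intro y
      obtain ⟨y, rfl⟩ := QuotientGroup.mk'_surjective M y
      have := (QuotientGroup.eq_one_iff (N := M) _).mpr (h y)
      rw [← QuotientGroup.mk'_apply, map_commutatorElement, commutatorElement_eq_one_iff_mul_comm] at this
      exact this.symm
    have key : γ n ≤ (Subgroup.center (G ⧸ M)).comap (QuotientGroup.mk' M) := by
      refine hle.trans (sup_le ((Subgroup.closure_le _).mpr fun s hs => ?_) fun x hx => ?_)
      · refine hcen fun y => ?_
        have hT' : Subgroup.closure T ≤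
            (Subgroup.centralizer {QuotientGroup.mk' M s}).comap (QuotientGroup.mk' M) := by
          refine (Subgroup.closure_le _).mpr fun t ht => ?_
          have h : ⁅s, t⁆ ∈ M :=
            (le_sup_left : _ ≤ M) (Subgroup.subset_closure (Set.mem_image2_of_mem hs ht))
          have := (QuotientGroup.eq_one_iff (N := M) _).mpr h
          rw [← QuotientGroup.mk'_apply, map_commutatorElement,
            commutatorElement_eq_one_iff_mul_comm] at this
          simpa [Subgroup.mem_centralizer_singleton_iff] using this.symm
        have hy := hT' (hT ▸ Subgroup.mem_top y)
        rw [Subgroup.mem_comap, Subgroup.mem_centralizer_singleton_iff] at hy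
        rw [← QuotientGroup.eq_one_iff (N := M), ← QuotientGroup.mk'_apply, map_commutatorElement,
          commutatorElement_eq_one_iff_mul_comm]
        exact hy.symm
      · exact hcen fun y => (le_sup_right : _ ≤ M) (hcomm (n + 1) hx y)
    rw [hγ, Subgroup.lowerCentralSeries_succ, Subgroup.commutator_le]
    intro x hx y _
    rw [← QuotientGroup.eq_one_iff (N := M), ← QuotientGroup.mk'_apply, map_commutatorElement,
      commutatorElement_eq_one_iff_mul_comm]
    exact (Subgroup.mem_center_iff.mp (key hx) _).symm

theorem wellFoundedGT_subgroup_of_lowerCentralSeries_eq_bot (n : ℕ) :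
    ∀ (G : Type*) [Group G] [Group.FG G], (⊤ : Subgroup G).lowerCentralSeries n = ⊥ →
      WellFoundedGT (Subgroup G) := by
  induction n with
  | zero =>
    intro G _ _ h
    have : Subsingleton (Subgroup G) := subsingleton_of_bot_eq_top (by simpa using h.symm)
    exact Finite.to_wellFoundedGT
  | succ n ih =>
    intro G _ _ h
    set A := (⊤ : Subgroup G).lowerCentralSeries n with hA
    have hcen (x : G) (hx : x ∈ A) (y : G) : x * y = y * x := by
      rw [← commutatorElement_eq_one_iff_mul_comm, ← Subgroup.mem_bot, ← h,
        Subgroup.lowerCentralSeries_succ]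
      exact Subgroup.commutator_mem_commutator hx (Subgroup.mem_top y)
    obtain ⟨S, hSfin, hS, hle⟩ := exists_finite_le_closure_sup_lowerCentralSeries (G := G) n
    rw [h, sup_bot_eq] at hle
    have hfg : A.FG := (Subgroup.fg_iff A).mpr ⟨S, le_antisymm ((Subgroup.closure_le _).mpr hS) hle, hSfin⟩
    have : Group.FG A := (Group.fg_iff_subgroup_fg A).mpr hfg
    have : WellFoundedGT (Subgroup A) := by
      let _ : CommGroup A := { (inferInstance : Group A) with
        mul_comm := fun x y => Subtype.ext (hcen x x.2 y) }
      exact wellFoundedGT_subgroup_of_commGroup_fg A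
    have : WellFoundedGT (Subgroup (G ⧸ A)) := by
      refine ih _ ?_
      rw [← Subgroup.map_top_of_surjective _ (QuotientGroup.mk'_surjective A),
        ← Subgroup.map_lowerCentralSeries, ← hA, QuotientGroup.map_mk'_self]
    have : WellFoundedGT (Subgroup (QuotientGroup.mk' A).ker) := by
      rwa [QuotientGroup.ker_mk']
    exact wellFoundedGT_subgroup_of_ker (QuotientGroup.mk' A)

theorem wellFoundedGT_subgroup_of_isNilpotent [Group.FG G] [hG : Group.IsNilpotent G] :
    WellFoundedGT (Subgroup G) := by
  obtain ⟨n, hn⟩ := Subgroup.nilpotent_iff_lowerCentralSeries.mp hG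
  exact wellFoundedGT_subgroup_of_lowerCentralSeries_eq_bot n G hn

end AscendingChain

/-! ### Isolators and the upper central series -/

section Isolator

variable {G Q : Type*} [Group G] [Group Q]

theorem TorsionFree.eq_one_of_pow_eq_one (hG : TorsionFree G) {x : G} {k : ℕ} (hk : 0 < k)
    (hx : x ^ k = 1) : x = 1 :=
  hG x (isOfFinOrder_iff_pow_eq_one.mpr ⟨k, hk, hx⟩)

theorem TorsionFree.of_injective (hQ : TorsionFree Q) {f : G →* Q}
    (hf : Function.Injective f) : TorsionFree G := fun _ hg =>
  hf ((hQ _ (f.isOfFinOrder hg)).trans f.map_one.symm)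

/-- Modulo `K`, elements of `L` are central. So conjugation by `y` fixes `x ^ k`, yet sends it to
`(⁅x, y⁆⁻¹ * x) ^ k = ⁅x, y⁆⁻¹ ^ k * x ^ k`. -/
theorem commutator_pow_mem_of_pow_mem {K L : Subgroup G} [K.Normal] {x : G} (y : G) {k : ℕ}
    (hKL : ∀ l ∈ L, ∀ z, ⁅l, z⁆ ∈ K) (hxy : ⁅x, y⁆ ∈ L) (hx : x ^ k ∈ L) : ⁅x, y⁆ ^ k ∈ K := by
  have hcomm (l : G) (hl : l ∈ L) (z : G) :
      QuotientGroup.mk' K l * QuotientGroup.mk' K z = QuotientGroup.mk' K z * QuotientGroup.mk' K l := by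
    rw [← commutatorElement_eq_one_iff_mul_comm, ← map_commutatorElement]
    exact (QuotientGroup.eq_one_iff _).mpr (hKL l hl z)
  have hconj : y * x * y⁻¹ = ⁅x, y⁆⁻¹ * x := by group
  rw [← QuotientGroup.eq_one_iff (N := K), ← QuotientGroup.mk'_apply]
  have h₁ : (QuotientGroup.mk' K) (y * x ^ k * y⁻¹) = QuotientGroup.mk' K (x ^ k) := by
    rw [map_mul, map_mul, ← hcomm _ hx, ← map_mul, ← map_mul, mul_inv_cancel_right]
  rw [← conj_pow, hconj, map_pow, map_mul, Commute.mul_pow (hcomm _ (L.inv_mem hxy) x), map_pow,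
    mul_eq_right, map_inv, inv_pow, inv_eq_one] at h₁
  rw [map_pow, h₁]

theorem TorsionFree.mem_upperCentralSeries_of_pow_mem_of_mem_succ (hG : TorsionFree G) {k : ℕ}
    (hk : 0 < k) (n : ℕ) : ∀ {x : G}, x ∈ Subgroup.upperCentralSeries G (n + 1) →
      x ^ k ∈ Subgroup.upperCentralSeries G n → x ∈ Subgroup.upperCentralSeries G n := by
  induction n with
  | zero =>
    intro x _ hxk
    exact hG.eq_one_of_pow_eq_one hk hxk
  | succ n ih =>
    intro x hx hxk y
    have hxy := Subgroup.mem_upperCentralSeries_succ_iff.mp hx y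
    exact ih hxy (commutator_pow_mem_of_pow_mem y
      (fun l hl => Subgroup.mem_upperCentralSeries_succ_iff.mp hl) hxy hxk)

/-- Descend from the term equal to `⊤`, one step of the series at a time. -/
theorem TorsionFree.mem_upperCentralSeries_of_pow_mem [hn : Group.IsNilpotent G]
    (hG : TorsionFree G) {x : G} {k : ℕ} (hk : 0 < k) (n : ℕ)
    (hx : x ^ k ∈ Subgroup.upperCentralSeries G n) : x ∈ Subgroup.upperCentralSeries G n := by
  obtain ⟨c, hc⟩ := hn
  obtain hcn | hnc := le_total c n
  · exact Subgroup.upperCentralSeries_mono G hcn (hc ▸ Subgroup.mem_top x)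
  · induction hnc using Nat.decreasingInduction with
    | of_succ m hm ih =>
      exact hG.mem_upperCentralSeries_of_pow_mem_of_mem_succ hk m
        (ih (Subgroup.upperCentralSeries_mono G m.le_succ hx)) hx
    | self => exact hc ▸ Subgroup.mem_top x

/-- The elements of `H` with a positive power in `⁅H, G⁆`. -/
def isolatedCommutator (H : Subgroup G) [H.Normal] : Subgroup G where
  carrier := {x | x ∈ H ∧ ∃ k : ℕ, 0 < k ∧ x ^ k ∈ ⁅H, (⊤ : Subgroup G)⁆}
  one_mem' := ⟨H.one_mem, 1, one_pos, by simp⟩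
  mul_mem' := by
    rintro x y ⟨hx, k, hk, hxk⟩ ⟨hy, l, hl, hyl⟩
    refine ⟨H.mul_mem hx hy, k * l, mul_pos hk hl, ?_⟩
    have hxy : Commute (QuotientGroup.mk' ⁅H, (⊤ : Subgroup G)⁆ x)
        (QuotientGroup.mk' ⁅H, (⊤ : Subgroup G)⁆ y) := by
      rw [← commutatorElement_eq_one_iff_commute, ← map_commutatorElement]
      exact (QuotientGroup.eq_one_iff _).mpr
        (Subgroup.commutator_mem_commutator hx (Subgroup.mem_top y))
    rw [← QuotientGroup.eq_one_iff, ← QuotientGroup.mk'_apply] at hxk hyl ⊢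
    rw [map_pow] at hxk hyl
    rw [map_pow, map_mul, hxy.mul_pow, pow_mul, hxk, one_pow, one_mul, mul_comm, pow_mul, hyl,
      one_pow]
  inv_mem' := by
    rintro x ⟨hx, k, hk, hxk⟩
    exact ⟨H.inv_mem hx, k, hk, by rw [inv_pow]; exact Subgroup.inv_mem _ hxk⟩

theorem isolatedCommutator_le (H : Subgroup G) [H.Normal] : isolatedCommutator H ≤ H :=
  fun _ hx => hx.1

theorem commutator_mem_isolatedCommutator {H : Subgroup G} [H.Normal] {x : G} (hx : x ∈ H) (y : G) :
    ⁅x, y⁆ ∈ isolatedCommutator H :=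
  have h := Subgroup.commutator_mem_commutator hx (Subgroup.mem_top y)
  ⟨Subgroup.commutator_le_left H ⊤ h, 1, one_pos, by rwa [pow_one]⟩

instance isolatedCommutator_normal (H : Subgroup G) [hH : H.Normal] :
    (isolatedCommutator H).Normal where
  conj_mem := by
    rintro x ⟨hx, k, hk, hxk⟩ g
    refine ⟨hH.conj_mem x hx g, k, hk, ?_⟩
    rw [conj_pow]
    exact Subgroup.Normal.conj_mem inferInstance _ hxk g

theorem torsionFree_quotient_isolatedCommutator (H : Subgroup G) [H.Normal]
    (hH : TorsionFree (G ⧸ H)) : TorsionFree (G ⧸ isolatedCommutator H) := by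
  intro x hx
  obtain ⟨x, rfl⟩ := QuotientGroup.mk_surjective x
  obtain ⟨k, hk, hxk⟩ := isOfFinOrder_iff_pow_eq_one.mp hx
  rw [← QuotientGroup.mk_pow, QuotientGroup.eq_one_iff] at hxk
  obtain ⟨hxH, l, hl, hxl⟩ := hxk
  rw [QuotientGroup.eq_one_iff]
  refine ⟨?_, k * l, mul_pos hk hl, by rwa [pow_mul]⟩
  rw [← QuotientGroup.eq_one_iff, QuotientGroup.mk_pow] at hxH
  exact (QuotientGroup.eq_one_iff _).mp (hH.eq_one_of_pow_eq_one hk hxH)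

theorem map_mem_isolatedCommutator {H : Subgroup G} [H.Normal] (φ : G →* G)
    (h : ∀ x ∈ H, φ x ∈ H) {x : G} (hx : x ∈ isolatedCommutator H) :
    φ x ∈ isolatedCommutator H := by
  obtain ⟨hx, k, hk, hxk⟩ := hx
  refine ⟨h x hx, k, hk, ?_⟩
  rw [← map_pow]
  have := Subgroup.mem_map_of_mem φ hxk
  rw [Subgroup.map_commutator] at this
  exact Subgroup.commutator_mono (Subgroup.map_le_iff_le_comap.mpr h) le_top this

theorem isolatedCommutator_le_upperCentralSeries [Group.IsNilpotent G] (hG : TorsionFree G)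
    {H : Subgroup G} [H.Normal] {n : ℕ} (hH : H ≤ Subgroup.upperCentralSeries G (n + 1)) :
    isolatedCommutator H ≤ Subgroup.upperCentralSeries G n := by
  rintro x ⟨-, k, hk, hxk⟩
  exact hG.mem_upperCentralSeries_of_pow_mem hk n
    (Subgroup.commutator_upperCentralSeries_top_le G n (Subgroup.commutator_mono hH le_rfl hxk))

theorem upperCentralSeries_comap_le {f : G →* Q} (hf : Function.Injective f) (n : ℕ) :
    (Subgroup.upperCentralSeries Q n).comap f ≤ Subgroup.upperCentralSeries G n := by
  induction n with
  | zero => simp [MonoidHom.comap_bot, (MonoidHom.ker_eq_bot_iff f).mpr hf]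
  | succ n ih =>
    intro x hx y
    refine ih ?_
    rw [Subgroup.mem_comap, map_commutatorElement]
    exact Subgroup.mem_upperCentralSeries_succ_iff.mp hx (f y)

theorem isNilpotent_of_injective [hQ : Group.IsNilpotent Q] {f : G →* Q}
    (hf : Function.Injective f) : Group.IsNilpotent G := by
  obtain ⟨n, hn⟩ := hQ
  exact ⟨n, top_le_iff.mp (le_trans (by simp [hn]) (upperCentralSeries_comap_le hf n))⟩

end Isolator

/-! ### Reidemeister numbers in equivariant extensions -/

section Reidemeister

variable {A G Q : Type*} [Group A] [Group G] [Group Q]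

/-- `A → G → Q` is a short exact sequence, equivariant for endomorphisms of the three groups. -/
structure EndExact (f : A →* G) (p : G →* Q) (α : A →* A) (φ : G →* G) (β : Q →* Q) : Prop where
  injective : Function.Injective f
  surjective : Function.Surjective p
  exact : f.range = p.ker
  comm_left : ∀ a, φ (f a) = f (α a)
  comm_right : ∀ g, p (φ g) = β (p g)

/-- Triviality of the group of fixed points. -/
def FixTrivial (φ : G →* G) : Prop := ∀ g, φ g = g → g = 1

theorem one_le_reidemeisterNumber (φ : G →* G) : 1 ≤ reidemeisterNumber φ := by
  have : Nonempty (Quotient (reidemeisterSetoid φ)) := ⟨⟦1⟧⟩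
  exact ENat.one_le_card_iff_nonempty _ |>.mpr this

theorem reidemeisterNumber_eq_top_iff {φ : G →* G} :
    reidemeisterNumber φ = ⊤ ↔ Infinite (Quotient (reidemeisterSetoid φ)) :=
  ENat.card_eq_top

theorem reidemeisterNumber_ne_top_iff {φ : G →* G} :
    reidemeisterNumber φ ≠ ⊤ ↔ Finite (Quotient (reidemeisterSetoid φ)) := by
  rw [Ne, reidemeisterNumber_eq_top_iff, not_infinite_iff_finite]

/-- Right translation by `g` carries the classes of the twisted map to those of `φ`. -/
theorem reidemeisterNumber_conj_comp (φ : G →* G) (g : G) :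
    reidemeisterNumber ((MulAut.conj g).toMonoidHom.comp φ) = reidemeisterNumber φ := by
  refine ENat.card_congr (Quotient.congr (Equiv.mulRight g) fun x y => ?_)
  refine exists_congr fun z => ?_
  simp only [Equiv.coe_mulRight, MonoidHom.comp_apply, MulEquiv.coe_toMonoidHom,
    MulAut.conj_apply, mul_inv_rev, inv_inv]
  rw [← mul_left_inj g]
  simp only [mul_assoc, inv_mul_cancel, mul_one]

theorem reidemeisterNumber_le_of_surjective {p : G →* Q} (hp : Function.Surjective p)
    {φ : G →* G} {β : Q →* Q} (h : ∀ g, p (φ g) = β (p g)) :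
    reidemeisterNumber β ≤ reidemeisterNumber φ := by
  have hmap : ∀ x y, (reidemeisterSetoid φ).r x y → (reidemeisterSetoid β).r (p x) (p y) := by
    rintro _ y ⟨z, rfl⟩
    exact ⟨p z, by simp [h]⟩
  have hsurj : Function.Surjective
      (Quotient.map (sa := reidemeisterSetoid φ) (sb := reidemeisterSetoid β) p hmap) :=
    Quotient.map_surjective _ hp
  exact ENat.card_le_card_of_injective (Function.injective_surjInv hsurj)

namespace EndExact

variable {f : A →* G} {p : G →* Q} {α : A →* A} {φ : G →* G} {β : Q →* Q}

theorem proj_incl (h : EndExact f p α φ β) (a : A) : p (f a) = 1 := by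
  rw [← MonoidHom.mem_ker, ← h.exact]
  exact ⟨a, rfl⟩

theorem exists_incl_eq (h : EndExact f p α φ β) {g : G} (hg : p g = 1) : ∃ a, f a = g := by
  rwa [← MonoidHom.mem_ker, ← h.exact] at hg

theorem reidemeisterNumber_left_le (h : EndExact f p α φ β) (hβ : FixTrivial β) :
    reidemeisterNumber α ≤ reidemeisterNumber φ := by
  refine ENat.card_le_card_of_injective
    (f := Quotient.map (sa := reidemeisterSetoid α) (sb := reidemeisterSetoid φ) f ?_) ?_
  · rintro _ y ⟨z, rfl⟩
    exact ⟨f z, by simp [h.comm_left]⟩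
  · intro x y
    refine Quotient.inductionOn₂ x y fun a b hab => ?_
    obtain ⟨z, hz⟩ := Quotient.exact hab
    have hz' := congrArg p hz
    rw [map_mul, map_mul, map_inv, h.comm_right, h.proj_incl, h.proj_incl, mul_one, eq_comm,
      mul_inv_eq_one] at hz'
    obtain ⟨c, rfl⟩ := h.exists_incl_eq (hβ _ hz'.symm)
    refine Quotient.sound ⟨c, h.injective ?_⟩
    rw [hz, h.comm_left, map_mul, map_mul, map_inv]

theorem fixTrivial (h : EndExact f p α φ β) (hα : FixTrivial α) (hβ : FixTrivial β) :
    FixTrivial φ := by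
  intro g hg
  obtain ⟨a, rfl⟩ := h.exists_incl_eq (hβ (p g) (by rw [← h.comm_right, hg]))
  rw [hα a (h.injective (by rw [← h.comm_left, hg])), map_one]

theorem reidemeisterNumber_eq_mul_of_central (h : EndExact f p α φ β)
    (hf : f.range ≤ Subgroup.center G)
    (hβ : ∀ q : Q, FixTrivial ((MulAut.conj q).toMonoidHom.comp β)) :
    reidemeisterNumber φ = reidemeisterNumber α * reidemeisterNumber β := by
  have hcen (a : A) (g : G) : g * f a = f a * g := Subgroup.mem_center_iff.mp (hf ⟨a, rfl⟩) g
  obtain ⟨s, hs⟩ := h.surjective.hasRightInverse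
  let σ : Quotient (reidemeisterSetoid β) → G := fun q => s q.out
  have hσ (q) : (⟦p (σ q)⟧ : Quotient (reidemeisterSetoid β)) = q := by
    simp only [σ, hs q.out, Quotient.out_eq]
  let F : Quotient (reidemeisterSetoid α) × Quotient (reidemeisterSetoid β) →
      Quotient (reidemeisterSetoid φ) := fun x =>
    Quotient.map (sa := reidemeisterSetoid α) (sb := reidemeisterSetoid φ)
      (fun a => f a * σ x.2) (by
        rintro _ y ⟨z, rfl⟩
        refine ⟨f z, ?_⟩
        simp only [map_mul, map_inv, h.comm_left]
        rw [← map_inv, mul_assoc (f z * f y), ← hcen (α z)⁻¹ (σ x.2)]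
        simp only [mul_assoc]) x.1
  have hF (a : A) (q) : F (⟦a⟧, q) = ⟦f a * σ q⟧ := rfl
  rw [reidemeisterNumber, reidemeisterNumber, reidemeisterNumber, ← ENat.card_prod]
  refine (ENat.card_congr (Equiv.ofBijective F ⟨?_, ?_⟩)).symm
  · rintro ⟨x, q⟩ ⟨y, r⟩
    refine Quotient.inductionOn₂ x y fun a b hab => ?_
    rw [hF, hF] at hab
    obtain ⟨z, hz⟩ := Quotient.exact hab
    have hz' := congrArg p hz
    rw [map_mul, map_mul, map_mul, map_mul, map_inv, h.comm_right, h.proj_incl, h.proj_incl,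
      one_mul, one_mul] at hz'
    obtain rfl : q = r := by
      rw [← hσ q, ← hσ r]
      exact Quotient.sound ⟨p z, hz'⟩
    -- The equation `hz'` says that `p z` is fixed by `β` followed by conjugation by `p (σ q)`.
    have hpz : p z = 1 := by
      refine hβ (p (σ q)) _ ?_
      rw [MonoidHom.comp_apply, MulEquiv.coe_toMonoidHom, MulAut.conj_apply]
      rw [eq_mul_inv_iff_mul_eq] at hz'
      rw [hz', mul_inv_cancel_right]
    obtain ⟨c, rfl⟩ := h.exists_incl_eq hpz
    rw [h.comm_left, ← map_inv, hcen, ← mul_assoc, ← mul_assoc, ← map_mul, ← map_mul,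
      mul_left_inj] at hz
    have hz := h.injective hz
    refine Prod.ext (Quotient.sound ⟨c, ?_⟩) rfl
    have hcomm (x y : A) : x * y = y * x :=
      h.injective (by rw [map_mul, map_mul, hcen])
    rw [hz, mul_assoc, hcomm]
  · intro x
    induction x using Quotient.inductionOn with | _ g
    obtain ⟨w, hw⟩ := Quotient.exact (hσ ⟦p g⟧)
    obtain ⟨z, rfl⟩ := h.surjective w
    have : p (σ ⟦p g⟧ * (z * g * (φ z)⁻¹)⁻¹) = 1 := by
      rw [map_mul, map_inv, map_mul, map_mul, map_inv, h.comm_right, ← hw, mul_inv_cancel]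
    obtain ⟨a, ha⟩ := h.exists_incl_eq this
    refine ⟨(⟦a⁻¹⟧, ⟦p g⟧), ?_⟩
    rw [hF]
    refine Quotient.sound ⟨z, ?_⟩
    rw [map_inv, inv_mul_eq_iff_eq_mul, ha, inv_mul_cancel_right]

end EndExact

/-- Fitting's argument for `θ a = a * (α a)⁻¹`: finiteness of `R(α)` makes the cokernel of `θ`,
hence of each `θ ^ n`, torsion, while the kernels of the `θ ^ n` stabilize. -/
theorem fixTrivial_of_comm [WellFoundedGT (Subgroup A)] (hA : TorsionFree A)
    (hcomm : ∀ a b : A, a * b = b * a) (α : A →* A) (hα : reidemeisterNumber α ≠ ⊤) :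
    FixTrivial α := by
  have := reidemeisterNumber_ne_top_iff.mp hα
  let _ : CommGroup A := { (inferInstance : Group A) with mul_comm := hcomm }
  let θ : Monoid.End A := MonoidHom.mk' (fun a => a * (α a)⁻¹) fun a b => by
    rw [map_mul, mul_inv]; exact mul_mul_mul_comm _ _ _ _
  have hθ (a : A) : θ a = a * (α a)⁻¹ := rfl
  have hpow (x : A) : ∃ m : ℕ, 0 < m ∧ ∃ y, x ^ m = θ y := by
    -- Two powers of `x` share a class, and their quotient is a value of `θ`.
    obtain ⟨i, j, hij, h⟩ := Finite.exists_ne_map_eq_of_infinite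
      fun n : ℕ => (⟦x ^ n⟧ : Quotient (reidemeisterSetoid α))
    wlog hlt : i < j generalizing i j
    · exact this j i hij.symm h.symm (by omega)
    obtain ⟨z, hz⟩ := Quotient.exact h.symm
    refine ⟨j - i, by omega, z, ?_⟩
    rw [hθ, pow_sub _ hlt.le, hz, mul_right_comm, mul_inv_cancel_right]
  let T (n : ℕ) : A →* A := θ ^ n
  have hT₁ (n : ℕ) (x : A) : T (n + 1) x = T n (θ x) := by
    change (θ ^ (n + 1)) x = _
    rw [pow_succ]
    rfl
  have hT₂ (n : ℕ) (x : A) : T (n + 1) x = θ (T n x) := by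
    change (θ ^ (n + 1)) x = _
    rw [pow_succ']
    rfl
  have hiter (n : ℕ) (x : A) : ∃ m : ℕ, 0 < m ∧ ∃ y, x ^ m = T n y := by
    induction n with
    | zero => exact ⟨1, one_pos, x, pow_one x⟩
    | succ n ih =>
      obtain ⟨m, hm, y, hy⟩ := ih
      obtain ⟨l, hl, w, hw⟩ := hpow y
      exact ⟨m * l, mul_pos hm hl, w, by rw [pow_mul, hy, ← map_pow, hw, hT₁]⟩
  have hmono : Monotone fun n => (T n).ker := by
    refine monotone_nat_of_le_succ fun n x hx => ?_
    rw [MonoidHom.mem_ker] at hx ⊢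
    rw [hT₂, hx, map_one]
  obtain ⟨n, hn⟩ := WellFoundedGT.monotone_chain_condition ⟨_, hmono⟩
  have hn : (T n).ker = (T (n + 1)).ker := hn (n + 1) n.le_succ
  intro x hx
  -- With `x ^ m = T n y` and `θ x = 1`, `y` lies in the kernel of `T (n + 1)`, hence of `T n`, so
  -- `x ^ m = 1`.
  obtain ⟨m, hm, y, hy⟩ := hiter n x
  have hy' : y ∈ (T n).ker := by
    rw [hn, MonoidHom.mem_ker, hT₂, ← hy, map_pow, hθ, hx, mul_inv_cancel, one_pow]
  exact hA.eq_one_of_pow_eq_one hm (hy.trans hy')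

end Reidemeister

/-! ### Induction along the upper central series -/

section ProductFormula

universe u

theorem TorsionFree.quotient_ker {G Q : Type*} [Group G] [Group Q] (hQ : TorsionFree Q)
    (p : G →* Q) : TorsionFree (G ⧸ p.ker) :=
  hQ.of_injective (QuotientGroup.kerLift_injective p)

namespace EndExact

variable {A G Q : Type u} [Group A] [Group G] [Group Q]
variable {f : A →* G} {p : G →* Q} {α : A →* A} {φ : G →* G} {β : Q →* Q}

/-- Inserts the isolator `H'` of `[ker p, G]`: `B` is `H'` seen in `A`, and `p'.ker` is the central
factor `ker p / H'`, with induced map `κ`. -/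
theorem exists_refinement [Group.IsNilpotent G] (hG : TorsionFree G)
    (h : EndExact f p α φ β) {n : ℕ} (hn : f.range ≤ Subgroup.upperCentralSeries G (n + 1)) :
    ∃ (φ' : G ⧸ isolatedCommutator p.ker →* G ⧸ isolatedCommutator p.ker)
      (p' : G ⧸ isolatedCommutator p.ker →* Q) (κ : p'.ker →* p'.ker) (B : Subgroup A)
      (b : B →* B) (q : A →* p'.ker),
      EndExact p'.ker.subtype p' κ φ' β ∧
      EndExact (f.comp B.subtype) (QuotientGroup.mk' (isolatedCommutator p.ker)) b φ φ' ∧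
      EndExact B.subtype q b α κ ∧
      p'.ker ≤ Subgroup.center _ ∧
      (f.comp B.subtype).range ≤ Subgroup.upperCentralSeries G n := by
  set H' := isolatedCommutator p.ker
  have hφ (x : G) (hx : x ∈ p.ker) : φ x ∈ p.ker := by
    rw [MonoidHom.mem_ker] at hx ⊢
    rw [h.comm_right, hx, map_one]
  have hφ' (x : G) (hx : x ∈ H') : φ x ∈ H' := map_mem_isolatedCommutator φ hφ hx
  let φ' : G ⧸ H' →* G ⧸ H' := QuotientGroup.map H' H' φ hφ'
  let p' : G ⧸ H' →* Q := QuotientGroup.lift H' p (isolatedCommutator_le p.ker)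
  have hφ'mk (x : G) : φ' (QuotientGroup.mk' H' x) = QuotientGroup.mk' H' (φ x) := rfl
  have hp'mk (x : G) : p' (QuotientGroup.mk' H' x) = p x := rfl
  have hp'φ' (x : G ⧸ H') : p' (φ' x) = β (p' x) := by
    obtain ⟨x, rfl⟩ := QuotientGroup.mk'_surjective H' x
    rw [hφ'mk, hp'mk, hp'mk, h.comm_right]
  let κ : p'.ker →* p'.ker := (φ'.comp p'.ker.subtype).codRestrict p'.ker fun x => by
    have hx : p' x = 1 := x.2
    rw [MonoidHom.mem_ker, MonoidHom.comp_apply, hp'φ', Subgroup.coe_subtype, hx, map_one]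
  let B : Subgroup A := H'.comap f
  let b : B →* B := (α.comp B.subtype).codRestrict B fun x => by
    rw [Subgroup.mem_comap, MonoidHom.comp_apply, ← h.comm_left]
    exact hφ' _ x.2
  let q : A →* p'.ker := ((QuotientGroup.mk' H').comp f).codRestrict p'.ker fun x => by
    rw [MonoidHom.mem_ker, MonoidHom.comp_apply, hp'mk, h.proj_incl]
  have hrange : (f.comp B.subtype).range = H' := by
    rw [MonoidHom.range_comp, Subgroup.range_subtype, Subgroup.map_comap_eq, inf_eq_right, h.exact]
    exact isolatedCommutator_le p.ker
  refine ⟨φ', p', κ, B, b, q, ⟨?_, ?_, ?_, ?_, ?_⟩, ⟨?_, ?_, ?_, ?_, ?_⟩, ⟨?_, ?_, ?_, ?_, ?_⟩, ?_, ?_⟩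
  · exact Subtype.val_injective
  · intro x
    obtain ⟨g, rfl⟩ := h.surjective x
    exact ⟨QuotientGroup.mk' H' g, rfl⟩
  · exact Subgroup.range_subtype _
  · exact fun _ => rfl
  · exact hp'φ'
  · exact h.injective.comp Subtype.val_injective
  · exact QuotientGroup.mk'_surjective H'
  · rw [hrange, QuotientGroup.ker_mk']
  · exact fun x => h.comm_left x
  · exact fun _ => rfl
  · exact Subtype.val_injective
  · rintro ⟨x, hx⟩
    obtain ⟨g, rfl⟩ := QuotientGroup.mk'_surjective H' x
    obtain ⟨a, rfl⟩ := h.exists_incl_eq (g := g) hx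
    exact ⟨a, rfl⟩
  · rw [Subgroup.range_subtype]
    ext x
    rw [MonoidHom.mem_ker, Subgroup.mem_comap, Subtype.ext_iff]
    exact (QuotientGroup.eq_one_iff (f x)).symm
  · exact fun _ => rfl
  · intro a
    refine Subtype.ext ?_
    change QuotientGroup.mk' H' (f (α a)) = φ' (QuotientGroup.mk' H' (f a))
    rw [hφ'mk, h.comm_left]
  · intro x hx
    obtain ⟨g, rfl⟩ := QuotientGroup.mk'_surjective H' x
    rw [Subgroup.mem_center_iff]
    intro y
    obtain ⟨y, rfl⟩ := QuotientGroup.mk'_surjective H' y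
    have hg : g ∈ p.ker := hx
    refine Eq.symm ?_
    rw [← commutatorElement_eq_one_iff_mul_comm, ← map_commutatorElement]
    exact (QuotientGroup.eq_one_iff _).mpr (commutator_mem_isolatedCommutator hg y)
  · rw [hrange]
    exact isolatedCommutator_le_upperCentralSeries hG (h.exact ▸ hn)

end EndExact

/-- Triviality of fixed points climbs from `Q` to `G ⧸ H'` through the abelian kernel, then to `G`
by induction. The abelian case applies since `R(κ) ≤ R(φ') ≤ R(φ)`, the first inequality because `β`
has no nontrivial fixed points. -/
theorem EndExact.fixTrivial_of_reidemeisterNumber_ne_top (n : ℕ) :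
    ∀ {A G Q : Type u} [Group A] [Group G] [Group Q] [Group.IsNilpotent G]
      [WellFoundedGT (Subgroup G)] {f : A →* G} {p : G →* Q} {α : A →* A} {φ : G →* G}
      {β : Q →* Q}, TorsionFree G → TorsionFree Q → EndExact f p α φ β →
      f.range ≤ Subgroup.upperCentralSeries G n → FixTrivial β → reidemeisterNumber φ ≠ ⊤ →
      FixTrivial φ := by
  induction n with
  | zero =>
    intro A G Q _ _ _ _ _ f p α φ β hG hQ h hn hβ hφ g hg
    have hpg : g ∈ p.ker := hβ _ (by rw [← h.comm_right, hg])
    rw [← h.exact] at hpg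
    exact hn hpg
  | succ n ih =>
    intro A G Q _ _ _ _ _ f p α φ β hG hQ h hn hβ hφ
    obtain ⟨φ', p', κ, B, b, q, h₁, h₂, -, hcen, hB⟩ := h.exists_refinement hG hn
    have hG' := torsionFree_quotient_isolatedCommutator _ (hQ.quotient_ker p)
    refine ih hG hG' h₂ hB (h₁.fixTrivial ?_ hβ) hφ
    have : WellFoundedGT (Subgroup (G ⧸ isolatedCommutator p.ker)) :=
      wellFoundedGT_subgroup_of_surjective _ h₂.surjective
    have : WellFoundedGT (Subgroup p'.ker) := wellFoundedGT_subgroup_of_injective _ h₁.injective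
    refine fixTrivial_of_comm (hG'.of_injective h₁.injective)
      (fun x y => Subtype.ext (Subgroup.mem_center_iff.mp (hcen y.2) x)) κ ?_
    exact ne_top_of_le_ne_top hφ ((h₁.reidemeisterNumber_left_le hβ).trans
      (reidemeisterNumber_le_of_surjective h₂.surjective h₂.comm_right))

theorem fixTrivial_of_isNilpotent {G : Type u} [Group G] [Group.IsNilpotent G]
    [WellFoundedGT (Subgroup G)] (hG : TorsionFree G) (φ : G →* G)
    (hφ : reidemeisterNumber φ ≠ ⊤) : FixTrivial φ := by
  obtain ⟨n, hn⟩ := Group.IsNilpotent.nilpotent G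
  -- Over the trivial quotient, the fixed-point condition there is vacuous.
  have h : EndExact (MonoidHom.id G) (1 : G →* PUnit.{u + 1}) φ φ (MonoidHom.id _) :=
    ⟨Function.injective_id, fun x => ⟨1, Subsingleton.elim _ x⟩, by ext; simp, fun _ => rfl,
      fun _ => rfl⟩
  exact EndExact.fixTrivial_of_reidemeisterNumber_ne_top n hG (fun _ _ => rfl) h (hn ▸ le_top)
    (fun _ _ => rfl) hφ

theorem EndExact.reidemeisterNumber_eq_mul_of_le_center {A G Q : Type u} [Group A] [Group G]
    [Group Q] [Group.IsNilpotent Q] [WellFoundedGT (Subgroup Q)] {f : A →* G} {p : G →* Q}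
    {α : A →* A} {φ : G →* G} {β : Q →* Q} (hQ : TorsionFree Q) (h : EndExact f p α φ β)
    (hf : f.range ≤ Subgroup.center G) :
    reidemeisterNumber φ = reidemeisterNumber α * reidemeisterNumber β := by
  by_cases hβ : reidemeisterNumber β = ⊤
  · rw [hβ, ENat.mul_top (zero_lt_one.trans_le (one_le_reidemeisterNumber α)).ne', ← top_le_iff,
      ← hβ]
    exact reidemeisterNumber_le_of_surjective h.surjective h.comm_right
  · refine h.reidemeisterNumber_eq_mul_of_central hf fun x => ?_
    exact fixTrivial_of_isNilpotent hQ _ (by rwa [reidemeisterNumber_conj_comp])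

theorem EndExact.reidemeisterNumber_eq_mul_of_le_upperCentralSeries (n : ℕ) :
    ∀ {A G Q : Type u} [Group A] [Group G] [Group Q] [Group.IsNilpotent G]
      [WellFoundedGT (Subgroup G)] {f : A →* G} {p : G →* Q} {α : A →* A} {φ : G →* G}
      {β : Q →* Q}, TorsionFree G → TorsionFree Q → EndExact f p α φ β →
      f.range ≤ Subgroup.upperCentralSeries G n →
      reidemeisterNumber φ = reidemeisterNumber α * reidemeisterNumber β := by
  induction n with
  | zero =>
    intro A G Q _ _ _ _ _ f p α φ β hG hQ h hn
    have := Group.nilpotent_of_surjective p h.surjective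
    have := wellFoundedGT_subgroup_of_surjective p h.surjective
    exact h.reidemeisterNumber_eq_mul_of_le_center hQ (hn.trans bot_le)
  | succ n ih =>
    intro A G Q _ _ _ _ _ f p α φ β hG hQ h hn
    have := Group.nilpotent_of_surjective p h.surjective
    have := wellFoundedGT_subgroup_of_surjective p h.surjective
    have := isNilpotent_of_injective h.injective
    have := wellFoundedGT_subgroup_of_injective f h.injective
    obtain ⟨φ', p', κ, B, b, q, h₁, h₂, h₃, hcen, hB⟩ := h.exists_refinement hG hn
    have hG' := torsionFree_quotient_isolatedCommutator _ (hQ.quotient_ker p)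
    rw [ih hG hG' h₂ hB, h₁.reidemeisterNumber_eq_mul_of_le_center hQ
      (by rwa [Subgroup.range_subtype]), ← mul_assoc]
    congr 1
    -- What remains is `R(α) = R(b) * R(κ)`, the induction hypothesis inside `A`; `B` lies in the
    -- `n`-th upper central term of `A` because that of `G` pulls back into it.
    refine (ih (hG.of_injective h.injective) (hG'.of_injective h₁.injective) h₃ ?_).symm
    refine le_trans ?_ (upperCentralSeries_comap_le h.injective n)
    rw [MonoidHom.range_comp, Subgroup.map_le_iff_le_comap] at hB
    exact hB

theorem EndExact.reidemeisterNumber_eq_mul {A G Q : Type u} [Group A] [Group G] [Group Q]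
    [Group.FG G] [Group.IsNilpotent G] {f : A →* G} {p : G →* Q} {α : A →* A} {φ : G →* G}
    {β : Q →* Q} (hG : TorsionFree G) (hQ : TorsionFree Q) (h : EndExact f p α φ β) :
    reidemeisterNumber φ = reidemeisterNumber α * reidemeisterNumber β := by
  have := wellFoundedGT_subgroup_of_isNilpotent (G := G)
  obtain ⟨n, hn⟩ := Group.IsNilpotent.nilpotent G
  exact EndExact.reidemeisterNumber_eq_mul_of_le_upperCentralSeries n hG hQ h (hn ▸ le_top)

/-! ### Restriction, quotient and the `R_∞`-property -/

theorem endExact_restrictEnd_quotientEnd {G : Type u} [Group G] (φ : G →* G) (H : Subgroup G)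
    [H.Normal] (hφ : H.map φ ≤ H) :
    EndExact H.subtype (QuotientGroup.mk' H) (restrictEnd φ H hφ) φ (quotientEnd φ H hφ) where
  injective := Subtype.val_injective
  surjective := QuotientGroup.mk'_surjective H
  exact := by rw [Subgroup.range_subtype, QuotientGroup.ker_mk']
  comm_left _ := rfl
  comm_right _ := rfl

theorem restrictEnd_bijective {G : Type u} [Group G] (ψ : MulAut G) (H : Subgroup G)
    (hψ : H.map ψ.toMonoidHom = H) : Function.Bijective (restrictEnd ψ.toMonoidHom H hψ.le) := by
  refine ⟨fun x y hxy => Subtype.ext (ψ.injective (congrArg Subtype.val hxy)), ?_⟩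
  rintro ⟨x, hx⟩
  obtain ⟨y, hy, rfl⟩ := hψ.ge hx
  exact ⟨⟨y, hy⟩, rfl⟩

theorem hasRInfinity_iff {G : Type u} [Group G] :
    HasRInfinity G ↔ ∀ ψ : MulAut G, reidemeisterNumber ψ.toMonoidHom = ⊤ := by
  rw [HasRInfinity, reidemeisterSpectrum, Set.range_eq_singleton_iff]

end ProductFormula

end TwistedConj

theorem mainTheorem6 {N : Type*} [Group N] [Group.FG N] [Group.IsNilpotent N]
    (hN : TwistedConj.TorsionFree N) (H : Subgroup N) [H.Normal]
    (hNH : TwistedConj.TorsionFree (N ⧸ H)) :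
    (∀ (φ : N →* N) (hφ : H.map φ ≤ H),
      TwistedConj.reidemeisterNumber φ =
        TwistedConj.reidemeisterNumber (TwistedConj.restrictEnd φ H hφ) *
          TwistedConj.reidemeisterNumber (TwistedConj.quotientEnd φ H hφ)) ∧
    (H.Characteristic → TwistedConj.HasRInfinity H → TwistedConj.HasRInfinity N) := by
  have key (φ : N →* N) (hφ : H.map φ ≤ H) :=
    (TwistedConj.endExact_restrictEnd_quotientEnd φ H hφ).reidemeisterNumber_eq_mul hN hNH
  refine ⟨key, fun hchar hH => TwistedConj.hasRInfinity_iff.mpr fun ψ => ?_⟩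
  have hψ : H.map ψ.toMonoidHom = H := Subgroup.characteristic_iff_map_eq.mp hchar ψ
  have htop : TwistedConj.reidemeisterNumber (TwistedConj.restrictEnd ψ.toMonoidHom H hψ.le) = ⊤ :=
    TwistedConj.hasRInfinity_iff.mp hH
      (MulEquiv.ofBijective _ (TwistedConj.restrictEnd_bijective ψ H hψ))
  -- The other factor is at least `1`, so the product with `⊤` is `⊤`.
  rw [key _ hψ.le, htop,
    ENat.top_mul (zero_lt_one.trans_le (TwistedConj.one_le_reidemeisterNumber _)).ne']
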